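/- Let $d(n)$ denote the number of positive divisors of $n$, let $\gamma$ be the Euler constant, and let $k\in\mathbb{C}$ be fixed with $\operatorname{Re} k>-1$. The generalized spectral zeta function $$Z(s,k)=\sum_{n=1}^{\infty}\frac{d(n)}{(n+k)^{s}},\qquad (n+k)^{s}=e^{s\ln(n+k)}\ \text{(principal branch)},$$ whose series converges absolutely for $\operatorname{Re}s>1$, has as a function of $s$ a meromorphic extension to all of $\mathbb{C}$. The extension has a double pole at $s=1$, with principal part $$\frac{1}{(s-1)^2}+\frac{2\gamma}{s-1}.$$ For every integer $n\ge 0$, its principal part at $s=-n$ is $$-\frac{k^{n+1}}{n+1}\,\frac{1}{s+n};$$ thus $s=-n$ is a simple pole with residue $-k^{n+1}/(n+1)$ if $k\neq 0$, and the extension is holomorphic at $s=-n$ if $k=0$. The extension has no other poles. -/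

import Mathlib

open Filter Topology

namespace SpectralZeta

/-- The divisor function `d(n)`, the number of positive divisors of `n`
(`1` and `n` included). -/
def divisorCount (n : ℕ) : ℕ := n.divisors.card

/-- The `n`-th term `d(n) / (n + k) ^ s` of the generalized spectral zeta series, where
`(n + k) ^ s = exp (s * log (n + k))` with the principal branch of the logarithm. -/
noncomputable def term (s k : ℂ) (n : ℕ+) : ℂ :=
  (divisorCount n : ℂ) / (((n : ℕ) : ℂ) + k) ^ s

/-- The generalized spectral zeta function `∑_{n ≥ 1} d(n) / (n + k) ^ s`, meaningful in the
half-plane `1 < re s`. -/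
noncomputable def genZeta (s k : ℂ) : ℂ := ∑' n : ℕ+, term s k n

/-- `f` has at `z₀` the principal part `P (1 / (z - z₀))`, where `P` is a polynomial without
constant term: the difference of `f` and this expression, on a punctured neighbourhood of `z₀`,
extends to a function analytic at `z₀`. -/
def HasPrincipalPartAt (f : ℂ → ℂ) (z₀ : ℂ) (P : Polynomial ℂ) : Prop :=
  P.coeff 0 = 0 ∧
    ∃ g : ℂ → ℂ, AnalyticAt ℂ g z₀ ∧ ∀ᶠ z in 𝓝[≠] z₀, f z = P.eval (z - z₀)⁻¹ + g z

end SpectralZeta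

namespace SpectralZeta

open Finset

/-! Fix `N > ‖k‖`. The terms with `n < N` form an entire function, since `n + k ≠ 0` for `n ≥ 1`. In
the rest, expand `(n + k)^(-s) = ∑ j, choose (-s) j * k^j * n^(-s-j)` and interchange the sums
(`hasSum_tail`). The coefficient of `choose (-s) j * k^j` is the tail from `N` of the Dirichlet
series of `ζ(s + j)^2`, which is `O(N^(-j))`. So the series over `j` converges locally uniformly
like a geometric series of ratio `‖k‖ / N`, once finitely many terms are set aside
(`analyticAt_tsum_tailTerm`).

Only the term with `s + j = 1` can be singular. At `s = 1` it is `j = 0`, with the double pole of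
`ζ^2`. At `s = -n` it is `j = n + 1`; there `choose (-s) (n + 1)` vanishes with derivative `-1 / (n
+ 1)`, leaving at most a simple pole (`hasPrincipalPartAt_tailTerm_succ`). -/

/-! ### Binomial coefficients and the binomial series. -/

theorem choose_neg_eq_prod (s : ℂ) (j : ℕ) :
    Ring.choose (-s) j = ∏ i ∈ range j, (-(s + i) / ((i : ℂ) + 1)) := by
  induction j with
  | zero => simp
  | succ j ih =>
    rw [prod_range_succ, ← ih, Ring.choose_eq_smul, Ring.choose_eq_smul,
      descPochhammer_succ_right, Polynomial.smeval_mul, Polynomial.smeval_sub,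
      Polynomial.smeval_X, Polynomial.smeval_natCast, Nat.factorial_succ]
    have h1 : ((j : ℂ) + 1) ≠ 0 := Nat.cast_add_one_ne_zero j
    have h2 : (j.factorial : ℂ) ≠ 0 := by exact_mod_cast j.factorial_ne_zero
    simp only [smul_eq_mul, pow_one, pow_zero, nsmul_eq_mul, mul_one]
    push_cast
    field_simp
    ring

theorem differentiable_choose_neg (j : ℕ) : Differentiable ℂ fun s : ℂ => Ring.choose (-s) j := by
  simp only [choose_neg_eq_prod]
  fun_prop

theorem norm_choose_neg_le {s : ℂ} {R : ℝ} (hs : ‖s‖ ≤ R) (j : ℕ) :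
    ‖Ring.choose (-s) j‖ ≤ ∏ i ∈ range j, ((R + i) / ((i : ℝ) + 1)) := by
  rw [choose_neg_eq_prod, norm_prod]
  refine prod_le_prod (fun _ _ => norm_nonneg _) fun i _ => ?_
  have h : ‖(i : ℂ) + 1‖ = (i : ℝ) + 1 := by exact_mod_cast Complex.norm_natCast (i + 1)
  rw [norm_div, norm_neg, h]
  gcongr
  refine (norm_add_le _ _).trans ?_
  rw [Complex.norm_natCast]
  gcongr

/-- Ratio test: consecutive terms have ratio `(R + n) / (n + 1) * r`, which tends to `r < 1`. -/
theorem summable_prod_mul_pow {R r : ℝ} (hR : 0 ≤ R) (hr : 0 ≤ r) (hr1 : r < 1) :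
    Summable fun j : ℕ => (∏ i ∈ range j, ((R + i) / ((i : ℝ) + 1))) * r ^ j := by
  obtain ⟨q, hq, hq1⟩ := exists_between hr1
  have hlim : Tendsto (fun n : ℕ => (R + n) / ((n : ℝ) + 1) * r) atTop (𝓝 (1 * r)) := by
    refine Tendsto.mul_const r ?_
    have h := (tendsto_one_div_add_atTop_nhds_zero_nat (𝕜 := ℝ)).const_mul (R - 1)
    have h' := h.const_add 1
    simp only [mul_zero, add_zero] at h'
    refine h'.congr fun n => ?_
    have : (n : ℝ) + 1 ≠ 0 := by positivity
    field_simp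
    ring
  rw [one_mul] at hlim
  refine summable_of_ratio_norm_eventually_le hq1 ?_
  filter_upwards [hlim.eventually_lt_const hq] with n hn
  rw [prod_range_succ, pow_succ]
  have h0 : 0 ≤ (R + n) / ((n : ℝ) + 1) * r := by positivity
  calc _ = ‖(∏ i ∈ range n, ((R + i) / ((i : ℝ) + 1))) * r ^ n‖ *
        ‖(R + n) / ((n : ℝ) + 1) * r‖ := by rw [← norm_mul]; congr 1; ring
    _ ≤ ‖(∏ i ∈ range n, ((R + i) / ((i : ℝ) + 1))) * r ^ n‖ * q := by
        gcongr
        rw [Real.norm_of_nonneg h0]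
        exact hn.le
    _ = _ := mul_comm _ _

theorem hasSum_choose_neg_mul_pow (s : ℂ) {x : ℂ} (hx : ‖x‖ < 1) :
    HasSum (fun j : ℕ => Ring.choose (-s) j * x ^ j) ((1 + x) ^ (-s)) := by
  have h := (Complex.one_add_cpow_hasFPowerSeriesOnBall_zero (a := -s)).hasSum (y := x)
    (by simpa [← ofReal_norm, ENNReal.ofReal_lt_one] using hx)
  rw [zero_add] at h
  refine h.congr_fun fun j => ?_
  rw [binomialSeries_apply, List.ofFn_const, List.prod_replicate, smul_eq_mul]

/-! ### The Dirichlet series of `d(n)` and its tails. -/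

@[simp]
theorem divisorCount_zero : divisorCount 0 = 0 := by simp [divisorCount]

open scoped LSeries.notation in
-- The divisor function is the Dirichlet convolution of the constant `1` with itself.
theorem hasSum_divisorCount_div_cpow {w : ℂ} (hw : 1 < w.re) :
    HasSum (fun n : ℕ => (divisorCount n : ℂ) / (n : ℂ) ^ w) (riemannZeta w ^ 2) := by
  have h1 := ArithmeticFunction.LSeriesHasSum_zeta hw
  have h := h1.convolution h1
  rw [← sq] at h
  refine h.congr_fun fun n => ?_
  rcases eq_or_ne n 0 with rfl | hn
  · simp
  rw [LSeries.term_of_ne_zero hn, LSeries.convolution_def]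
  beta_reduce
  rw [Nat.sum_divisorsAntidiagonal (f := fun a b : ℕ =>
      ((ArithmeticFunction.zeta a : ℕ) : ℂ) * ((ArithmeticFunction.zeta b : ℕ) : ℂ)),
    sum_congr rfl (g := fun _ => (1 : ℂ)), divisorCount]
  · simp
  · intro d hd
    have hd' := Nat.dvd_of_mem_divisors hd
    have h0 : d ≠ 0 := (Nat.pos_of_mem_divisors hd).ne'
    have h1 : n / d ≠ 0 := (Nat.div_pos (Nat.divisor_le hd) (Nat.pos_of_ne_zero h0)).ne'
    rw [ArithmeticFunction.zeta_apply_ne h0, ArithmeticFunction.zeta_apply_ne h1]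
    simp

/-- The analytic continuation of `∑_{n ≥ N} d(n) / n ^ w`. -/
noncomputable def divisorTail (N : ℕ) (w : ℂ) : ℂ :=
  riemannZeta w ^ 2 - ∑ n ∈ range N, (divisorCount n : ℂ) / (n : ℂ) ^ w

theorem hasSum_divisorTail (N : ℕ) {w : ℂ} (hw : 1 < w.re) :
    HasSum (fun n : ℕ => (divisorCount (n + N) : ℂ) / ((n + N : ℕ) : ℂ) ^ w) (divisorTail N w) := by
  rw [divisorTail]
  exact (hasSum_nat_add_iff' N).mpr (hasSum_divisorCount_div_cpow hw)

theorem norm_divisorCount_div_cpow_add {n : ℕ} (hn : 0 < n) (w : ℂ) (i : ℕ) :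
    ‖(divisorCount n : ℂ) / (n : ℂ) ^ (w + i)‖ =
      (divisorCount n : ℝ) / (n : ℝ) ^ w.re * ((n : ℝ)⁻¹) ^ i := by
  rw [norm_div, Complex.norm_natCast, Complex.norm_natCast_cpow_of_pos hn, Complex.add_re,
    Complex.natCast_re, Real.rpow_add (by exact_mod_cast hn), Real.rpow_natCast, inv_pow,
    ← div_div, div_eq_mul_inv _ ((n : ℝ) ^ i)]

theorem summable_divisorCount_div_rpow (N : ℕ) {x : ℝ} (hx : 1 < x) :
    Summable fun n : ℕ => (divisorCount (n + N) : ℝ) / ((n + N : ℕ) : ℝ) ^ x := by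
  have h := (hasSum_divisorTail N (w := x) (by simpa using hx)).summable.norm
  refine h.congr fun n => ?_
  rw [norm_div, Complex.norm_natCast, Complex.norm_natCast_cpow_of_re_ne_zero _
    (by rw [Complex.ofReal_re]; linarith), Complex.ofReal_re]

theorem norm_divisorTail_add_le {N : ℕ} (hN : 0 < N) {x : ℝ} (hx : 1 < x) {w : ℂ} (hw : x ≤ w.re)
    (i : ℕ) : ‖divisorTail N (w + i)‖ ≤
      (∑' n : ℕ, (divisorCount (n + N) : ℝ) / ((n + N : ℕ) : ℝ) ^ x) * ((N : ℝ)⁻¹) ^ i := by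
  have hre : 1 < (w + i).re := by
    rw [Complex.add_re, Complex.natCast_re]
    have : (0 : ℝ) ≤ i := i.cast_nonneg
    linarith
  rw [← (hasSum_divisorTail N hre).tsum_eq, ← tsum_mul_right]
  refine tsum_of_norm_bounded ((summable_divisorCount_div_rpow N hx).mul_right _).hasSum fun n => ?_
  rw [norm_divisorCount_div_cpow_add (by omega)]
  have h1 : (1 : ℝ) ≤ ((n + N : ℕ) : ℝ) := by exact_mod_cast (by omega : 1 ≤ n + N)
  have h2 : (N : ℝ) ≤ ((n + N : ℕ) : ℝ) := by exact_mod_cast (by omega : N ≤ n + N)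
  have h3 : (0 : ℝ) < N := by exact_mod_cast hN
  gcongr

/-! ### Expansion of the tail in powers of `k`. -/

/-- The terms of the expansion of `∑_{n ≥ N} d(n) / (n + k) ^ s` in powers of `k`. -/
noncomputable def tailTerm (k : ℂ) (N : ℕ) (j : ℕ) (s : ℂ) : ℂ :=
  Ring.choose (-s) j * k ^ j * divisorTail N (s + j)

/-- Shifting by `J` moves `s + J` into the half-plane of absolute convergence. The bound depends on
`s` only through `R` and `x`, as the Weierstrass test requires. -/
theorem norm_tailTerm_add_le {k : ℂ} {N : ℕ} (hN : 0 < N) {J : ℕ} {R x : ℝ} (hx : 1 < x) {s : ℂ}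
    (hs : ‖s‖ ≤ R) (hJ : x - J ≤ s.re) (i : ℕ) :
    ‖tailTerm k N (i + J) s‖ ≤
      (∏ l ∈ range (i + J), ((R + l) / ((l : ℝ) + 1))) * (‖k‖ / N) ^ (i + J) *
        ((N : ℝ) ^ J * ∑' n : ℕ, (divisorCount (n + N) : ℝ) / ((n + N : ℕ) : ℝ) ^ x) := by
  have h3 : (0 : ℝ) < N := by exact_mod_cast hN
  have h := norm_divisorTail_add_le hN hx (w := s + J) (by simp; linarith) i
  have e : s + ((i + J : ℕ) : ℂ) = s + J + i := by push_cast; ring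
  rw [tailTerm, e, norm_mul, norm_mul, norm_pow]
  have hR : 0 ≤ R := (norm_nonneg s).trans hs
  calc _ ≤ (∏ l ∈ range (i + J), ((R + l) / ((l : ℝ) + 1))) * ‖k‖ ^ (i + J) *
        ((∑' n : ℕ, (divisorCount (n + N) : ℝ) / ((n + N : ℕ) : ℝ) ^ x) * ((N : ℝ)⁻¹) ^ i) := by
        have hp : 0 ≤ ∏ l ∈ range (i + J), ((R + l) / ((l : ℝ) + 1)) :=
          prod_nonneg fun l _ => by positivity
        gcongr
        exact norm_choose_neg_le hs _
    _ = _ := by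
        rw [div_pow, inv_pow, pow_add (N : ℝ)]
        field_simp

theorem summable_tailTerm_bound {k : ℂ} {N : ℕ} (hk : ‖k‖ < N) (J : ℕ) {R : ℝ} (hR : 0 ≤ R)
    (C : ℝ) : Summable fun i : ℕ =>
      (∏ l ∈ range (i + J), ((R + l) / ((l : ℝ) + 1))) * (‖k‖ / N) ^ (i + J) * C := by
  have h3 : (0 : ℝ) < N := (norm_nonneg k).trans_lt hk
  exact ((summable_nat_add_iff J).mpr (summable_prod_mul_pow hR (by positivity)
    ((div_lt_one h3).mpr hk))).mul_right C

theorem natCast_pos_of_norm_lt {k : ℂ} {N : ℕ} (hk : ‖k‖ < N) : 0 < N := by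
  exact_mod_cast (norm_nonneg k).trans_lt hk

theorem summable_tailTerm {k : ℂ} {N : ℕ} (hk : ‖k‖ < N) (s : ℂ) :
    Summable fun j => tailTerm k N j s := by
  obtain ⟨J, hJ⟩ := exists_nat_ge (2 - s.re)
  rw [← summable_nat_add_iff J]
  exact Summable.of_norm_bounded (summable_tailTerm_bound hk J (norm_nonneg s) _)
    (norm_tailTerm_add_le (natCast_pos_of_norm_lt hk) one_lt_two le_rfl (by linarith))

theorem differentiable_divisorCount_div_cpow (n : ℕ) :
    Differentiable ℂ fun w : ℂ => (divisorCount n : ℂ) / (n : ℂ) ^ w := by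
  rcases eq_or_ne n 0 with rfl | hn
  · simp
  have h : (n : ℂ) ≠ 0 := by exact_mod_cast hn
  exact fun w => (differentiableAt_const _).div
    (differentiableAt_id.const_cpow (Or.inl h)) (by simp [Complex.cpow_eq_zero_iff, h])

theorem differentiableAt_divisorTail (N : ℕ) {w : ℂ} (hw : w ≠ 1) :
    DifferentiableAt ℂ (divisorTail N) w :=
  ((differentiableAt_riemannZeta hw).pow 2).sub
    (DifferentiableAt.fun_sum fun n _ => differentiable_divisorCount_div_cpow n w)

theorem differentiableAt_tailTerm (k : ℂ) (N j : ℕ) {s : ℂ} (hs : s + j ≠ 1) :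
    DifferentiableAt ℂ (tailTerm k N j) s := by
  refine ((differentiable_choose_neg j s).mul_const _).mul ?_
  exact DifferentiableAt.comp s (differentiableAt_divisorTail N hs)
    (differentiableAt_id.add_const _)

theorem analyticAt_tsum_tailTerm {k : ℂ} {N : ℕ} (hk : ‖k‖ < N) {J : ℕ} {s : ℂ}
    (hs : 2 - J < s.re) : AnalyticAt ℂ (fun s => ∑' i, tailTerm k N (i + J) s) s := by
  have hU : IsOpen ({s : ℂ | 2 - (J : ℝ) < s.re} ∩ Metric.ball 0 (‖s‖ + 1)) :=
    (isOpen_lt continuous_const Complex.continuous_re).inter Metric.isOpen_ball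
  have hmem : s ∈ {s : ℂ | 2 - (J : ℝ) < s.re} ∩ Metric.ball 0 (‖s‖ + 1) := ⟨hs, by simp⟩
  refine DifferentiableOn.analyticAt (Complex.differentiableOn_tsum_of_summable_norm
    (summable_tailTerm_bound hk J (R := ‖s‖ + 1) (by positivity) _) (fun i w hw => ?_) hU
    (fun i w hw => norm_tailTerm_add_le (natCast_pos_of_norm_lt hk) one_lt_two
      ((mem_ball_zero_iff.mp hw.2).le) (by have := hw.1; simp at this; linarith) i)) (hU.mem_nhds hmem)
  refine (differentiableAt_tailTerm k N _ fun h => ?_).differentiableWithinAt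
  have h1 := congrArg Complex.re h
  have h2 := hw.1
  have h3 : (0 : ℝ) ≤ i := i.cast_nonneg
  simp at h1 h2
  linarith

theorem divisorCount_div_add_cpow {k : ℂ} {n : ℕ} (hk : ‖k‖ < n) (s : ℂ) :
    HasSum (fun j : ℕ => Ring.choose (-s) j * k ^ j *
      ((divisorCount n : ℂ) / (n : ℂ) ^ (s + j))) ((divisorCount n : ℂ) / ((n : ℂ) + k) ^ s) := by
  have hn : (0 : ℝ) < n := (norm_nonneg k).trans_lt hk
  have hn0 : (n : ℂ) ≠ 0 := by exact_mod_cast hn.ne'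
  have hx : ‖k / n‖ < 1 := by
    rw [norm_div, Complex.norm_natCast]
    exact (div_lt_one hn).mpr hk
  have h1 : 1 + k / n ≠ 0 := fun h => by
    rw [eq_neg_of_add_eq_zero_right h] at hx
    simp at hx
  have e : (n : ℂ) + k = ((n : ℝ) : ℂ) * (1 + k / n) := by
    rw [Complex.ofReal_natCast]
    field_simp
  have e2 : ((n : ℂ) + k) ^ s = (n : ℂ) ^ s * (1 + k / n) ^ s := by
    -- The principal logarithm splits over this product because the factor `n` is a positive real.
    rw [e, Complex.cpow_def_of_ne_zero (mul_ne_zero (by simpa using hn0) h1),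
      Complex.log_ofReal_mul hn h1, add_mul, Complex.exp_add, Complex.cpow_def_of_ne_zero hn0,
      Complex.cpow_def_of_ne_zero h1, Complex.ofReal_log hn.le, Complex.ofReal_natCast]
  rw [e2, ← div_div, div_eq_mul_inv _ ((1 + k / n) ^ s), ← Complex.cpow_neg]
  refine ((hasSum_choose_neg_mul_pow s hx).mul_left _).congr_fun fun j => ?_
  rw [Complex.cpow_add _ _ hn0, Complex.cpow_natCast, div_pow]
  ring

theorem summable_tail_prod {k : ℂ} {N : ℕ} (hk : ‖k‖ < N) {s : ℂ} (hs : 1 < s.re) :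
    Summable fun p : ℕ × ℕ => Ring.choose (-s) p.1 * k ^ p.1 *
      ((divisorCount (p.2 + N) : ℂ) / ((p.2 + N : ℕ) : ℂ) ^ (s + p.1)) := by
  have hN := natCast_pos_of_norm_lt hk
  have h3 : (0 : ℝ) < N := by exact_mod_cast hN
  have hb := (summable_prod_mul_pow (norm_nonneg s) (r := ‖k‖ / N) (by positivity)
    ((div_lt_one h3).mpr hk)).mul_of_nonneg (summable_divisorCount_div_rpow N hs)
    (fun j => mul_nonneg (prod_nonneg fun l _ => by positivity) (by positivity))
    (fun n => by positivity)
  refine Summable.of_norm_bounded hb fun p => ?_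
  rw [norm_mul, norm_mul, norm_pow, norm_divisorCount_div_cpow_add (by omega)]
  have h2 : (N : ℝ) ≤ ((p.2 + N : ℕ) : ℝ) := by exact_mod_cast (by omega : N ≤ p.2 + N)
  have hp : 0 ≤ ∏ l ∈ range p.1, ((‖s‖ + l) / ((l : ℝ) + 1)) :=
    prod_nonneg fun l _ => by positivity
  calc _ ≤ (∏ l ∈ range p.1, ((‖s‖ + l) / ((l : ℝ) + 1))) * ‖k‖ ^ p.1 *
        ((divisorCount (p.2 + N) : ℝ) / ((p.2 + N : ℕ) : ℝ) ^ s.re * ((N : ℝ)⁻¹) ^ p.1) := by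
        gcongr
        exact norm_choose_neg_le le_rfl _
    _ = _ := by
        rw [div_pow, inv_pow]
        ring

/-- Fubini for the absolutely summable double family: summing over `n` first gives the `tailTerm`s,
over `j` first the binomial series. -/
theorem hasSum_tail {k : ℂ} {N : ℕ} (hk : ‖k‖ < N) {s : ℂ} (hs : 1 < s.re) :
    HasSum (fun n : ℕ => (divisorCount (n + N) : ℂ) / (((n + N : ℕ) : ℂ) + k) ^ s)
      (∑' j, tailTerm k N j s) := by
  have hprod := summable_tail_prod hk hs
  have hrow (j : ℕ) : HasSum (fun n : ℕ => Ring.choose (-s) j * k ^ j *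
      ((divisorCount (n + N) : ℂ) / ((n + N : ℕ) : ℂ) ^ (s + j))) (tailTerm k N j s) := by
    refine (hasSum_divisorTail N ?_).mul_left _
    rw [Complex.add_re, Complex.natCast_re]
    have : (0 : ℝ) ≤ j := j.cast_nonneg
    linarith
  have hcol (n : ℕ) := divisorCount_div_add_cpow (k := k) (n := n + N)
    (hk.trans_le (by exact_mod_cast (by omega : N ≤ n + N))) s
  have h1 := hprod.hasSum.prod_fiberwise hrow
  have h2 := ((Equiv.prodComm ℕ ℕ).hasSum_iff.mpr hprod.hasSum).prod_fiberwise hcol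
  rwa [← h1.tsum_eq] at h2

/-- The meromorphic continuation of `∑_{n ≥ 1} d(n) / (n + k) ^ s`, for any `N > ‖k‖`. -/
noncomputable def continuation (k : ℂ) (N : ℕ) (s : ℂ) : ℂ :=
  ∑ n ∈ range N, (divisorCount n : ℂ) / ((n : ℂ) + k) ^ s + ∑' j, tailTerm k N j s

theorem hasSum_term {k : ℂ} {N : ℕ} (hk : ‖k‖ < N) {s : ℂ} (hs : 1 < s.re) :
    HasSum (term s k) (continuation k N s) := by
  have h := hasSum_tail hk hs
  have h' := (hasSum_nat_add_iff (f := fun n : ℕ => (divisorCount n : ℂ) / ((n : ℂ) + k) ^ s)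
    N).mp h
  refine (hasSum_pnat_iff (f := fun n : ℕ => (divisorCount n : ℂ) / ((n : ℂ) + k) ^ s)).mpr ?_
  simpa [continuation, add_comm] using h'


/-! ### Principal parts, pole orders and the Laurent expansion of `ζ^2`. -/

theorem HasPrincipalPartAt.congr_add_analyticAt {f g h : ℂ → ℂ} {z₀ : ℂ} {P : Polynomial ℂ}
    (hf : HasPrincipalPartAt f z₀ P) (hg : AnalyticAt ℂ g z₀) (hh : ∀ z, h z = f z + g z) :
    HasPrincipalPartAt h z₀ P := by
  obtain ⟨h0, e, he, hfe⟩ := hf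
  refine ⟨h0, fun z => e z + g z, he.fun_add hg, ?_⟩
  filter_upwards [hfe] with z hz
  rw [hh, hz, add_assoc]

theorem HasPrincipalPartAt.meromorphicAt {f : ℂ → ℂ} {z₀ : ℂ} {P : Polynomial ℂ}
    (hf : HasPrincipalPartAt f z₀ P) : MeromorphicAt f z₀ := by
  obtain ⟨-, g, hg, hfg⟩ := hf
  have hinv : MeromorphicAt (fun z : ℂ => (z - z₀)⁻¹) z₀ := by fun_prop
  have hP : MeromorphicAt (fun z => P.eval (z - z₀)⁻¹) z₀ := by
    simp only [Polynomial.eval_eq_sum_range]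
    exact MeromorphicAt.fun_sum fun i _ => (MeromorphicAt.const _ _).fun_mul (hinv.fun_pow _)
  exact (hP.fun_add hg.meromorphicAt).congr (hfg.mono fun z hz => hz.symm)

theorem HasPrincipalPartAt.meromorphicOrderAt_eq_neg_one {f : ℂ → ℂ} {z₀ c : ℂ} (hc : c ≠ 0)
    (hf : HasPrincipalPartAt f z₀ (Polynomial.C c * Polynomial.X)) :
    meromorphicOrderAt f z₀ = (-1 : ℤ) := by
  rw [meromorphicOrderAt_eq_int_iff hf.meromorphicAt]
  obtain ⟨-, g, hg, hfg⟩ := hf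
  refine ⟨fun z => c + (z - z₀) * g z, by fun_prop, by simpa using hc, ?_⟩
  filter_upwards [hfg, self_mem_nhdsWithin] with z hz hne
  have : z - z₀ ≠ 0 := sub_ne_zero.mpr hne
  rw [hz, zpow_neg_one]
  simp only [Polynomial.eval_mul, Polynomial.eval_C, Polynomial.eval_X, smul_eq_mul]
  field_simp

theorem HasPrincipalPartAt.meromorphicOrderAt_eq_neg_two {f : ℂ → ℂ} {z₀ c : ℂ}
    (hf : HasPrincipalPartAt f z₀ (Polynomial.X ^ 2 + Polynomial.C c * Polynomial.X)) :
    meromorphicOrderAt f z₀ = (-2 : ℤ) := by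
  rw [meromorphicOrderAt_eq_int_iff hf.meromorphicAt]
  obtain ⟨-, g, hg, hfg⟩ := hf
  refine ⟨fun z => 1 + (z - z₀) * c + (z - z₀) ^ 2 * g z, by fun_prop, by simp, ?_⟩
  filter_upwards [hfg, self_mem_nhdsWithin] with z hz hne
  have : z - z₀ ≠ 0 := sub_ne_zero.mpr hne
  rw [hz, zpow_neg, zpow_ofNat]
  simp only [Polynomial.eval_add, Polynomial.eval_pow, Polynomial.eval_mul, Polynomial.eval_C,
    Polynomial.eval_X, smul_eq_mul]
  field_simp

theorem exists_eq_add_sub_mul {f : ℂ → ℂ} (hf : Differentiable ℂ f) (z₀ : ℂ) :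
    ∃ g : ℂ → ℂ, Differentiable ℂ g ∧ ∀ z, f z = f z₀ + (z - z₀) * g z := by
  refine ⟨dslope f z₀, ?_, fun z => ?_⟩
  · rw [← differentiableOn_univ, Complex.differentiableOn_dslope univ_mem]
    exact hf.differentiableOn
  · rw [← smul_eq_mul, sub_smul_dslope]
    ring

/-- Square `ζ(s) = 1 / (s - 1) + γ + (s - 1) * g(s)` with `g` entire. -/
theorem riemannZeta_sq_eq : ∃ H : ℂ → ℂ, Differentiable ℂ H ∧ ∀ s ≠ 1, riemannZeta s ^ 2 =
    (s - 1)⁻¹ ^ 2 + 2 * (Real.eulerMascheroniConstant : ℂ) * (s - 1)⁻¹ + H s := by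
  obtain ⟨g, hg, hg'⟩ := exists_eq_add_sub_mul differentiable_riemannZeta₀ 1
  refine ⟨fun s => 2 * g s + riemannZeta₀ s ^ 2, by fun_prop, fun s hs => ?_⟩
  have hs' := sub_ne_zero.mpr hs
  have h := hg' s
  rw [riemannZeta₀_one] at h
  beta_reduce
  rw [riemannZeta_eq_inv_sub_add hs, h]
  field_simp
  ring

/-! ### Singularities of the continuation. -/

theorem analyticAt_tailTerm (k : ℂ) (N : ℕ) {j : ℕ} {s : ℂ} (hs : s + j ≠ 1) :
    AnalyticAt ℂ (tailTerm k N j) s := by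
  have hU : IsOpen {s : ℂ | s + j ≠ 1} := isOpen_ne_fun (by fun_prop) (by fun_prop)
  exact DifferentiableOn.analyticAt
    (fun w hw => (differentiableAt_tailTerm k N j hw).differentiableWithinAt) (hU.mem_nhds hs)

theorem differentiable_sum_div_add_cpow {k : ℂ} (hk : -1 < k.re) (N : ℕ) :
    Differentiable ℂ fun s : ℂ => ∑ n ∈ range N, (divisorCount n : ℂ) / ((n : ℂ) + k) ^ s := by
  refine Differentiable.fun_sum fun n _ => ?_
  rcases eq_or_ne n 0 with rfl | hn
  -- The term `n = 0` vanishes since `d(0) = 0`, so `k = 0` causes no trouble.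
  · simp
  have h : (n : ℂ) + k ≠ 0 := fun h => by
    have h1 := congrArg Complex.re h
    have h2 : (1 : ℝ) ≤ n := by exact_mod_cast Nat.one_le_iff_ne_zero.mpr hn
    simp at h1
    linarith
  exact fun w => (differentiableAt_const _).div
    (differentiableAt_id.const_cpow (Or.inl h)) (by simp [Complex.cpow_eq_zero_iff, h])

theorem exists_continuation_eq_add {k : ℂ} (hk : -1 < k.re) {N : ℕ} (hkN : ‖k‖ < N) {s₀ : ℂ}
    {j₀ : ℕ} (h : ∀ j ≠ j₀, AnalyticAt ℂ (tailTerm k N j) s₀) :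
    ∃ g : ℂ → ℂ, AnalyticAt ℂ g s₀ ∧ ∀ s, continuation k N s = tailTerm k N j₀ s + g s := by
  obtain ⟨J₁, hJ₁⟩ := exists_nat_gt (2 - s₀.re)
  -- `J` must exceed `j₀`, so that the singular term lies in the finite part split off.
  set J := J₁ + j₀ + 1 with hJdef
  have hJ : 2 - (J : ℝ) < s₀.re := by
    have : (0 : ℝ) ≤ j₀ := j₀.cast_nonneg
    rw [hJdef]
    push_cast
    linarith
  refine ⟨fun s => ∑ n ∈ range N, (divisorCount n : ℂ) / ((n : ℂ) + k) ^ s +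
    ∑ j ∈ (range J).erase j₀, tailTerm k N j s + ∑' i, tailTerm k N (i + J) s, ?_, fun s => ?_⟩
  · exact (((differentiable_sum_div_add_cpow hk N).analyticAt s₀).fun_add
      (Finset.analyticAt_fun_sum _ fun j hj => h j (ne_of_mem_erase hj))).fun_add
      (analyticAt_tsum_tailTerm hkN hJ)
  · rw [continuation, ← (summable_tailTerm hkN s).sum_add_tsum_nat_add J,
      ← add_sum_erase _ _ (mem_range.mpr (show j₀ < J by omega))]
    ring

theorem analyticAt_continuation {k : ℂ} (hk : -1 < k.re) {N : ℕ} (hkN : ‖k‖ < N) {s : ℂ}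
    (hs : s ≠ 1) (hs' : k = 0 ∨ ∀ n : ℕ, s ≠ -(n : ℂ)) : AnalyticAt ℂ (continuation k N) s := by
  have h0 : AnalyticAt ℂ (tailTerm k N 0) s := analyticAt_tailTerm k N (by simpa using hs)
  obtain ⟨g, hg, he⟩ := exists_continuation_eq_add hk hkN (s₀ := s) (j₀ := 0) fun j hj => by
    obtain ⟨n, rfl⟩ := Nat.exists_eq_succ_of_ne_zero hj
    rcases hs' with rfl | hs'
    · have : tailTerm 0 N n.succ = fun _ => 0 := by
        funext s
        simp [tailTerm]
      rw [this]
      exact analyticAt_const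
    · refine analyticAt_tailTerm k N fun h => hs' n ?_
      push_cast at h
      linear_combination h
  rw [funext he]
  exact h0.fun_add hg

theorem exists_tailTerm_eq (k : ℂ) (N j : ℕ) : ∃ D : ℂ → ℂ, Differentiable ℂ D ∧ ∀ s,
    tailTerm k N j s = Ring.choose (-s) j * k ^ j * riemannZeta (s + j) ^ 2 + D s := by
  refine ⟨fun s => -(Ring.choose (-s) j * k ^ j *
    ∑ n ∈ range N, (divisorCount n : ℂ) / (n : ℂ) ^ (s + j)), ?_, fun s => ?_⟩
  · refine (((differentiable_choose_neg j).mul_const _).mul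
      (Differentiable.fun_sum fun n _ => ?_)).neg
    exact (differentiable_divisorCount_div_cpow n).comp (differentiable_id.add_const _)
  · rw [tailTerm, divisorTail]
    ring

theorem hasPrincipalPartAt_tailTerm_zero (k : ℂ) (N : ℕ) :
    HasPrincipalPartAt (tailTerm k N 0) 1 (Polynomial.X ^ 2 +
      Polynomial.C (2 * (Real.eulerMascheroniConstant : ℂ)) * Polynomial.X) := by
  obtain ⟨D, hD, hD'⟩ := exists_tailTerm_eq k N 0
  obtain ⟨H, hH, hH'⟩ := riemannZeta_sq_eq
  refine ⟨by simp, fun s => H s + D s, (hH.add hD).analyticAt _, ?_⟩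
  filter_upwards [self_mem_nhdsWithin] with s hs
  rw [hD']
  simp [hH' s hs, add_assoc]

theorem choose_neg_succ (s : ℂ) (n : ℕ) :
    Ring.choose (-s) (n + 1) = -(s + n) / ((n : ℂ) + 1) * Ring.choose (-s) n := by
  rw [choose_neg_eq_prod, choose_neg_eq_prod, prod_range_succ, mul_comm]

theorem hasPrincipalPartAt_tailTerm_succ (k : ℂ) (N n : ℕ) :
    HasPrincipalPartAt (tailTerm k N (n + 1)) (-(n : ℂ))
      (Polynomial.C (-(k ^ (n + 1) / ((n : ℂ) + 1))) * Polynomial.X) := by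
  obtain ⟨D, hD, hD'⟩ := exists_tailTerm_eq k N (n + 1)
  obtain ⟨H, hH, hH'⟩ := riemannZeta_sq_eq
  obtain ⟨e, he, he'⟩ := exists_eq_add_sub_mul (differentiable_choose_neg n) (-(n : ℂ))
  have h1 : Ring.choose (- -(n : ℂ)) n = 1 := by
    rw [neg_neg, Ring.choose_natCast, Nat.choose_self, Nat.cast_one]
  set c := -(k ^ (n + 1) / ((n : ℂ) + 1)) with hc
  set γ := (Real.eulerMascheroniConstant : ℂ)
  -- With `u = s + n`, this is what remains of `c * u * (1 + u * e) * (u⁻² + 2γ * u⁻¹ + H)` after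
  -- removing `c * u⁻¹`, plus the entire correction `D`.
  refine ⟨by simp, fun s => c * (e s + 2 * γ + 2 * γ * (s + n) * e s +
    (s + n) * (1 + (s + n) * e s) * H (s + n + 1)) + D s, ?_, ?_⟩
  · have hH1 : Differentiable ℂ fun s : ℂ => H (s + n + 1) := hH.comp (by fun_prop)
    exact Differentiable.analyticAt (by fun_prop) _
  · filter_upwards [self_mem_nhdsWithin] with s hs
    have hs0 : s + n ≠ 0 := fun h => hs (eq_neg_of_add_eq_zero_left h)
    have hn : (n : ℂ) + 1 ≠ 0 := Nat.cast_add_one_ne_zero n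
    have hch := he' s
    rw [h1, sub_neg_eq_add] at hch
    have hz := hH' (s + n + 1) (by simpa using hs0)
    rw [add_sub_cancel_right] at hz
    rw [hD', choose_neg_succ, hch, Nat.cast_succ, ← add_assoc, hz, hc]
    simp only [Polynomial.eval_mul, Polynomial.eval_C, Polynomial.eval_X, sub_neg_eq_add]
    field_simp
    ring

theorem hasPrincipalPartAt_continuation_one {k : ℂ} (hk : -1 < k.re) {N : ℕ} (hkN : ‖k‖ < N) :
    HasPrincipalPartAt (continuation k N) 1 (Polynomial.X ^ 2 +
      Polynomial.C (2 * (Real.eulerMascheroniConstant : ℂ)) * Polynomial.X) := by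
  obtain ⟨g, hg, he⟩ := exists_continuation_eq_add hk hkN (s₀ := 1) (j₀ := 0) fun j hj =>
    analyticAt_tailTerm k N (by simpa using hj)
  exact (hasPrincipalPartAt_tailTerm_zero k N).congr_add_analyticAt hg he

theorem hasPrincipalPartAt_continuation_neg {k : ℂ} (hk : -1 < k.re) {N : ℕ} (hkN : ‖k‖ < N)
    (n : ℕ) : HasPrincipalPartAt (continuation k N) (-(n : ℂ))
      (Polynomial.C (-(k ^ (n + 1) / ((n : ℂ) + 1))) * Polynomial.X) := by
  obtain ⟨g, hg, he⟩ := exists_continuation_eq_add hk hkN (s₀ := -(n : ℂ)) (j₀ := n + 1)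
    fun j hj => analyticAt_tailTerm k N fun h => hj <| by
      have : (j : ℂ) = ((n + 1 : ℕ) : ℂ) := by
        push_cast
        linear_combination h
      exact_mod_cast this
  exact (hasPrincipalPartAt_tailTerm_succ k N n).congr_add_analyticAt hg he

end SpectralZeta

theorem theorem5 (k : ℂ) (hk : -1 < k.re) :
    (∀ s : ℂ, 1 < s.re → Summable (SpectralZeta.term s k)) ∧
    ∃ Z : ℂ → ℂ,
      -- `Z` is a meromorphic extension to the whole plane
      Meromorphic Z ∧
      (∀ s : ℂ, 1 < s.re → Z s = SpectralZeta.genZeta s k) ∧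
      -- there are no poles except at `1` and, if `k ≠ 0`, at `0, -1, -2, …`
      (∀ s : ℂ, s ≠ 1 → (k = 0 ∨ ∀ n : ℕ, s ≠ -(n : ℂ)) → AnalyticAt ℂ Z s) ∧
      -- a double pole at `1`, with its principal part
      meromorphicOrderAt Z 1 = (-2 : ℤ) ∧
      SpectralZeta.HasPrincipalPartAt Z 1
        (Polynomial.X ^ 2 +
          Polynomial.C (2 * (Real.eulerMascheroniConstant : ℂ)) * Polynomial.X) ∧
      -- the principal part at `-n`, which is that of a simple pole if `k ≠ 0`
      ∀ n : ℕ,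
        (k ≠ 0 → meromorphicOrderAt Z (-(n : ℂ)) = (-1 : ℤ)) ∧
        SpectralZeta.HasPrincipalPartAt Z (-(n : ℂ))
          (Polynomial.C (-(k ^ (n + 1) / ((n : ℂ) + 1))) * Polynomial.X) := by
  open SpectralZeta in
  obtain ⟨N, hN⟩ := exists_nat_gt ‖k‖
  have h1 := hasPrincipalPartAt_continuation_one hk hN
  have hneg := hasPrincipalPartAt_continuation_neg hk hN
  refine ⟨fun s hs => (hasSum_term hN hs).summable, continuation k N, fun s => ?_,
    fun s hs => (hasSum_term hN hs).tsum_eq.symm, fun s hs hs' => analyticAt_continuation hk hN hs hs',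
    h1.meromorphicOrderAt_eq_neg_two, h1, fun n => ⟨fun hk0 => ?_, hneg n⟩⟩
  · rcases eq_or_ne s 1 with rfl | hs
    · exact h1.meromorphicAt
    · by_cases h : ∃ n : ℕ, s = -(n : ℂ)
      · obtain ⟨n, rfl⟩ := h
        exact (hneg n).meromorphicAt
      · push Not at h
        exact (analyticAt_continuation hk hN hs (Or.inr h)).meromorphicAt
  · exact (hneg n).meromorphicOrderAt_eq_neg_one
      (neg_ne_zero.mpr (div_ne_zero (pow_ne_zero _ hk0) (Nat.cast_add_one_ne_zero n)))
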